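/- Let $n\ge 1$, $d\ge 0$, let $F\in\mathbb{R}^{d\times n}$ (row $i$ holds the predictions of the $i$-th ensemble member on the $n$ test examples) with columns $x_1,\dots,x_n\in\mathbb{R}^d$, and let $b\in\mathbb{R}^d$ be such that $Z=\{z\in[-1,1]^n:\tfrac1n Fz\ge b\}$ is non-empty (inequalities between vectors are coordinatewise). Let $\ell_+,\ell_-:[-1,1]\to\mathbb{R}$ be continuous and, on $(-1,1)$, twice differentiable, with $\ell_+$ nonincreasing and $\ell_-$ nondecreasing. Put $\Gamma=\ell_- -\ell_+$, $\Gamma^{-1}(m)=\min\{g\in[-1,1]:\Gamma(g)=m\}$, and $$\Psi(m)=\begin{cases}-m+2\ell_-(-1), & m\le\Gamma(-1),\\ \ell_+(\Gamma^{-1}(m))+\ell_-(\Gamma^{-1}(m)), & \Gamma(-1)<m<\Gamma(1),\\ m+2\ell_+(1), & m\ge\Gamma(1),\end{cases}$$ and assume that $\Psi$ is convex and differentiable on $\mathbb{R}$. For $c\ge 0$ consider the game with value $$V_c=\min_{g\in[-1,1]^n}\ \min_{p\in[0,1]^n}\ \max_{z\in Z}\ \frac1n\sum_{j=1}^n\Big(p_j\Big[\tfrac{1+z_j}{2}\ell_+(g_j)+\tfrac{1-z_j}{2}\ell_-(g_j)\Big]+(1-p_j)c\Big).$$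 Let $\phi(x)=\Psi(x)-x\Psi'(x)$, which is nondecreasing on $x<0$ and nonincreasing on $x\ge0$, and let $\phi_+^{-1}(\lambda)=\inf\{x\ge 0:\phi(x)\le\lambda\}$ and $\phi_-^{-1}(\lambda)=\sup\{x<0:\phi(x)\le\lambda\}$ be the corresponding generalized inverses, with $\inf\emptyset=+\infty$, $\sup\emptyset=-\infty$ and $\Psi'(\pm\infty)=\lim_{m\to\pm\infty}\Psi'(m)=\pm1$. For $\sigma\in\mathbb{R}^d$ and $p>0$ let $K_{j,\sigma}(p)=\phi(x_j^\top\sigma/p)=\frac{\partial}{\partial p}\big[p\,\Psi(x_j^\top\sigma/p)\big]$, which is nondecreasing in $p$, and $K_{j,\sigma}^{-1}(\lambda)=\inf\{p>0:K_{j,\sigma}(p)\ge\lambda\}\in[0,+\infty]$. Define $$Q_j(\sigma,\lambda)=\begin{cases}(x_j^\top\sigma)\,\Psi'\big(\phi^{-1}_{\operatorname{sgn}(x_j^\top\sigma)}(\lambda)\big), & \lambda\le K_{j,\sigma}(1),\\ \Psi(x_j^\top\sigma)-\lambda, & \lambda>K_{j,\sigma}(1),\end{cases}$$ where $\phi^{-1}_{\operatorname{sgn}(s)}$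 is $\phi_+^{-1}$ for $s\ge0$ and $\phi_-^{-1}$ for $s<0$. Then the maximum and the minima defining $V_c$ are attained, and $$V_c=\frac12\min_{\sigma\ge 0}\Big[-b^\top\sigma+\frac1n\sum_{j=1}^nQ_j(\sigma,2c)\Big]+c,$$ where the minimum over $\sigma$ is attained. Moreover, if $\sigma^*\ge0$ is any minimizer of the right-hand side, then the strategy $$p_j^*=\min\big(1,K_{j,\sigma^*}^{-1}(2c)\big),\qquad g_j^*=\begin{cases}-1, & x_j^\top\sigma^*\le p_j^*\,\Gamma(-1),\\ \Gamma^{-1}\big(x_j^\top\sigma^*/p_j^*\big), & p_j^*\,\Gamma(-1)<x_j^\top\sigma^*<p_j^*\,\Gamma(1),\\ 1, & x_j^\top\sigma^*\ge p_j^*\,\Gamma(1)\end{cases}$$ ($j=1,\dots,n$) belongs to $[0,1]^n\times[-1,1]^n$ and is minimax optimal, i.e. its worst-case loss over $z\in Z$ equals $V_c$. (Should the first and third case defining $g_j^*$ both apply, the first is used.) -/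

import Mathlib

namespace AbstainGame

noncomputable section

/-- Standing assumption on the partial losses `lp` (label `+1`) and `lm` (label `-1`), which are
real-valued on `[-1, 1]`; their values outside `[-1, 1]` are never used. -/
structure IsPartialLosses (lp lm : ℝ → ℝ) : Prop where
  continuous_lp : ContinuousOn lp (Set.Icc (-1) 1)
  continuous_lm : ContinuousOn lm (Set.Icc (-1) 1)
  antitone_lp : AntitoneOn lp (Set.Ioo (-1) 1)
  monotone_lm : MonotoneOn lm (Set.Ioo (-1) 1)
  differentiable_lp : DifferentiableOn ℝ lp (Set.Ioo (-1) 1)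
  differentiable_lm : DifferentiableOn ℝ lm (Set.Ioo (-1) 1)
  differentiable_deriv_lp : DifferentiableOn ℝ (deriv lp) (Set.Ioo (-1) 1)
  differentiable_deriv_lm : DifferentiableOn ℝ (deriv lm) (Set.Ioo (-1) 1)

section Potential

/-- The score function `Γ = ℓ₋ - ℓ₊`. -/
def score (lp lm : ℝ → ℝ) (g : ℝ) : ℝ := lm g - lp g

/-- The pseudoinverse `Γ⁻¹(m) = min {g ∈ [-1, 1] : Γ(g) = m}`. -/
def scoreInv (lp lm : ℝ → ℝ) (m : ℝ) : ℝ :=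
  sInf {g : ℝ | g ∈ Set.Icc (-1) 1 ∧ score lp lm g = m}

open Classical in
/-- The potential well `Ψ`. -/
def potential (lp lm : ℝ → ℝ) (m : ℝ) : ℝ :=
  if m ≤ score lp lm (-1) then -m + 2 * lm (-1)
  else if score lp lm 1 ≤ m then m + 2 * lp 1
  else lp (scoreInv lp lm m) + lm (scoreInv lp lm m)

/-- `φ(x) = Ψ(x) - x Ψ'(x)`. -/
def phi (lp lm : ℝ → ℝ) (x : ℝ) : ℝ :=
  potential lp lm x - x * deriv (potential lp lm) x

/-- For an example with score `s = xⱼᵀσ`, the function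
`K(q) = Ψ(s/q) - (s/q) Ψ'(s/q)` of `q > 0`, i.e. the derivative of `q ↦ q Ψ(s/q)`. -/
def K (lp lm : ℝ → ℝ) (s q : ℝ) : ℝ :=
  potential lp lm (s / q) - s / q * deriv (potential lp lm) (s / q)

/-- The generalized inverse `K⁻¹(t) = inf {q > 0 : K(q) ≥ t}` of the nondecreasing function `K`,
with the usual convention `inf ∅ = +∞`. -/
def KInv (lp lm : ℝ → ℝ) (s t : ℝ) : EReal :=
  sInf ((fun q : ℝ => (q : EReal)) '' {q : ℝ | 0 < q ∧ t ≤ K lp lm s q})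

/-- The inverse of the nonincreasing restriction of `φ` to `x ≥ 0`, with `inf ∅ = +∞`. -/
def phiInvPos (lp lm : ℝ → ℝ) (t : ℝ) : EReal :=
  sInf ((fun x : ℝ => (x : EReal)) '' {x : ℝ | 0 ≤ x ∧ phi lp lm x ≤ t})

/-- The inverse of the nondecreasing restriction of `φ` to `x < 0`, with `sup ∅ = -∞`. -/
def phiInvNeg (lp lm : ℝ → ℝ) (t : ℝ) : EReal :=
  sSup ((fun x : ℝ => (x : EReal)) '' {x : ℝ | x < 0 ∧ phi lp lm x ≤ t})

open Classical in
/-- `Ψ'` on the extended line: `Ψ'(±∞) = ±1` are the limits of `Ψ'`, since `Ψ` is affine with slope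
`1` above `Γ(1)` and with slope `-1` below `Γ(-1)`. -/
def slope (lp lm : ℝ → ℝ) (x : EReal) : ℝ :=
  if x = ⊤ then 1 else if x = ⊥ then -1 else deriv (potential lp lm) x.toReal

open Classical in
/-- The abstaining potential well `Q(s, t)`, as a function of the score `s = xⱼᵀσ`. -/
def Q (lp lm : ℝ → ℝ) (s t : ℝ) : ℝ :=
  if t ≤ K lp lm s 1 then
    s * slope lp lm (if 0 ≤ s then phiInvPos lp lm t else phiInvNeg lp lm t)
  else potential lp lm s - t

/-- The prediction probability `min(1, K⁻¹(2c))` for an example with score `s`. -/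
def optProb (lp lm : ℝ → ℝ) (c s : ℝ) : ℝ :=
  (min 1 (KInv lp lm s (2 * c))).toReal

open Classical in
/-- The prediction for an example with score `s` and prediction probability `q`. -/
def optPred (lp lm : ℝ → ℝ) (q s : ℝ) : ℝ :=
  if s ≤ q * score lp lm (-1) then -1
  else if q * score lp lm 1 ≤ s then 1
  else scoreInv lp lm (s / q)

end Potential

section Game

variable {d n : ℕ}

/-- The adversary's strategies: `z ∈ [-1, 1]ⁿ` with `(1/n) F z ≥ b`. -/
def feasible (F : Matrix (Fin d) (Fin n) ℝ) (b : Fin d → ℝ) : Set (Fin n → ℝ) :=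
  {z | z ∈ Set.Icc (-1) 1 ∧ b ≤ (1 / (n : ℝ)) • F.mulVec z}

/-- The expected abstaining loss averaged over the test data: predictions `g`, prediction
probabilities `q`, labels `z`. -/
def avgLoss (lp lm : ℝ → ℝ) (c : ℝ) (g q z : Fin n → ℝ) : ℝ :=
  (1 / (n : ℝ)) * ∑ j, (q j * ((1 + z j) / 2 * lp (g j) + (1 - z j) / 2 * lm (g j))
    + (1 - q j) * c)

/-- The worst-case loss of the strategy `(g, q)`. -/
def worstLoss (lp lm : ℝ → ℝ) (c : ℝ) (F : Matrix (Fin d) (Fin n) ℝ) (b : Fin d → ℝ)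
    (g q : Fin n → ℝ) : ℝ :=
  sSup (avgLoss lp lm c g q '' feasible F b)

/-- The predictor's strategies: pairs `(g, q) ∈ [-1, 1]ⁿ × [0, 1]ⁿ`. -/
def strategies (n : ℕ) : Set ((Fin n → ℝ) × (Fin n → ℝ)) :=
  Set.Icc (-1) 1 ×ˢ Set.Icc 0 1

/-- The value `V_c` of the game. -/
def gameValue (lp lm : ℝ → ℝ) (c : ℝ) (F : Matrix (Fin d) (Fin n) ℝ) (b : Fin d → ℝ) : ℝ :=
  sInf ((fun s => worstLoss lp lm c F b s.1 s.2) '' strategies n)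

/-- The score `xⱼᵀσ` of the test example `j`, where `xⱼ` is the `j`-th column of `F`. -/
def exampleScore (F : Matrix (Fin d) (Fin n) ℝ) (σ : Fin d → ℝ) (j : Fin n) : ℝ :=
  F.transpose.mulVec σ j

/-- The objective `-bᵀσ + (1/n) ∑ⱼ Qⱼ(σ, t)`. -/
def slack (lp lm : ℝ → ℝ) (F : Matrix (Fin d) (Fin n) ℝ) (b : Fin d → ℝ) (t : ℝ)
    (σ : Fin d → ℝ) : ℝ :=
  -(b ⬝ᵥ σ) + (1 / (n : ℝ)) * ∑ j, Q lp lm (exampleScore F σ j) t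

end Game

end

end AbstainGame

namespace AbstainGame

/-! ### Tangents of differentiable convex functions on the line -/

section Convex

variable {f : ℝ → ℝ}

/-! For a fixed strategy `(g, q)` the adversary solves a linear program. Duality turns twice its
value, less `2c`, into the minimum over `σ ≥ 0` of `-bᵀσ + (1/n) ∑ⱼ [qⱼ(ℓ₊ + ℓ₋)(gⱼ) + |sⱼ - qⱼ
Γ(gⱼ)| - 2c qⱼ]`, where `sⱼ = xⱼᵀσ` (`dualLoss`). The game is then a double minimization, so the
order is free and no minimax theorem is needed; for fixed `σ` the strategy separates over the
examples.

In one coordinate, minimizing over `g` for `q > 0` gives the perspective `q Ψ(s/q)`, and minimizing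
`q Ψ(s/q) - q t` over `q ∈ [0, 1]` gives `Q(s, t)`. The lower bound (`Q_le_dualLoss`) uses a tangent
of `Ψ`: since `Ψ ∘ Γ = ℓ₊ + ℓ₋` and `|Ψ'| ≤ 1`, the tangent at any `y` gives `q φ(y) + s Ψ'(y) ≤
q(ℓ₊ + ℓ₋)(g) + |s - q Γ(g)|`, and `φ(y) = t` cancels `q`. Equality at the stated strategy is
`dualLoss_opt`. Points with equal `φ` on one ray have equal `Ψ'`, so the choices made by generalized
inverses are harmless. -/

theorem ConvexOn.tangent_le (hf : ConvexOn ℝ Set.univ f) (hd : Differentiable ℝ f) (x y : ℝ) :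
    f y + deriv f y * (x - y) ≤ f x := by
  rcases lt_trichotomy y x with h | rfl | h
  · have := hf.deriv_le_slope (Set.mem_univ y) (Set.mem_univ x) h (hd y)
    rw [slope_def_field, le_div_iff₀ (sub_pos.2 h)] at this
    linarith
  · simp
  · have := hf.slope_le_deriv (Set.mem_univ x) (Set.mem_univ y) h (hd y)
    rw [slope_def_field, div_le_iff₀ (sub_pos.2 h)] at this
    linarith

theorem ConvexOn.monotone_deriv (hf : ConvexOn ℝ Set.univ f) (hd : Differentiable ℝ f) :
    Monotone (deriv f) := by
  simpa using hf.monotoneOn_deriv (fun x _ => hd x)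

/-- The hypothesis says, for both signs at once, that `y` lies beyond `x` as seen from `0`; for `x =
0` it holds for every `y`. -/
theorem ConvexOn.mul_deriv_sub_nonneg (hf : ConvexOn ℝ Set.univ f) (hd : Differentiable ℝ f)
    {x y : ℝ} (h : 0 ≤ x * (y - x)) : 0 ≤ x * (deriv f y - deriv f x) := by
  have hm := ConvexOn.monotone_deriv hf hd
  rcases lt_trichotomy x y with hxy | rfl | hxy
  · have hx : 0 ≤ x := nonneg_of_mul_nonneg_left h (sub_pos.2 hxy)
    exact mul_nonneg hx (sub_nonneg.2 (hm hxy.le))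
  · simp
  · have hx : x ≤ 0 := nonpos_of_mul_nonneg_left h (sub_neg.2 hxy)
    exact mul_nonneg_of_nonpos_of_nonpos hx (sub_nonpos.2 (hm hxy.le))

theorem ConvexOn.tangent_intercept_le (hf : ConvexOn ℝ Set.univ f) (hd : Differentiable ℝ f)
    {x y : ℝ} (h : 0 ≤ x * (y - x)) : f y - y * deriv f y ≤ f x - x * deriv f x := by
  have h₁ := ConvexOn.tangent_le hf hd x y
  have h₂ := ConvexOn.mul_deriv_sub_nonneg hf hd h
  linarith

/-- Equal intercepts force the tangent at `y` to touch `f` at `x` as well, so `f` minus that tangent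
has a minimum at `x`. -/
theorem ConvexOn.deriv_eq_of_tangent_intercept_eq (hf : ConvexOn ℝ Set.univ f)
    (hd : Differentiable ℝ f) {x y : ℝ} (h : 0 ≤ x * (y - x))
    (he : f x - x * deriv f x = f y - y * deriv f y) : deriv f x = deriv f y := by
  have h₁ := ConvexOn.tangent_le hf hd x y
  have h₂ := ConvexOn.mul_deriv_sub_nonneg hf hd h
  have h₃ : f x = f y + deriv f y * (x - y) := by linarith
  have hmin : IsLocalMin (fun u => f u - (f y + deriv f y * (u - y))) x := by
    refine Filter.Eventually.of_forall fun u => ?_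
    have := ConvexOn.tangent_le hf hd u y
    simp only
    linarith
  have hder : HasDerivAt (fun u => f u - (f y + deriv f y * (u - y)))
      (deriv f x - deriv f y * 1) x :=
    (hd x).hasDerivAt.sub ((((hasDerivAt_id x).sub_const y).const_mul _).const_add _)
  have := hmin.hasDerivAt_eq_zero hder
  linarith

theorem ConvexOn.continuous_deriv_of_abs_le_one (hf : ConvexOn ℝ Set.univ f)
    (hd : Differentiable ℝ f) (hb : ∀ x, |deriv f x| ≤ 1) : Continuous (deriv f) := by
  have hm := ConvexOn.monotone_deriv hf hd
  -- A monotone surjection is continuous. Adding `x` makes the bounded derivative surjective: by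
  -- Darboux's theorem the derivative of `f + x²/2` attains `y`, which lies strictly between its
  -- values at `y - 2` and `y + 2`.
  have hcont : Continuous (fun x => deriv f x + x) := by
    refine Monotone.continuous_of_surjective (fun x y h => add_le_add (hm h) h) fun y => ?_
    have hder : ∀ x ∈ Set.Icc (y - 2) (y + 2),
        HasDerivWithinAt (fun u => f u + u ^ 2 / 2) (deriv f x + x) (Set.Icc (y - 2) (y + 2)) x := by
      intro x _
      have h := (hd x).hasDerivAt.add (((hasDerivAt_id x).pow 2).div_const 2)
      refine (h.congr_deriv ?_).hasDerivWithinAt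
      simp
    obtain ⟨x, _, hx⟩ := exists_hasDerivWithinAt_eq_of_gt_of_lt (by linarith) hder
      (m := y) (by linarith [(abs_le.1 (hb (y - 2))).2]) (by linarith [(abs_le.1 (hb (y + 2))).1])
    exact ⟨x, hx⟩
  exact (hcont.sub continuous_id).congr fun x => add_sub_cancel_right _ _

end Convex

/-! ### Farkas' lemma and linear programming duality -/

section Duality

theorem farkas {ι W : Type*} [AddCommGroup W] [Module ℝ W] (s : Finset ι) :
    ∀ (A : ι → W →ₗ[ℝ] ℝ) (γ : W →ₗ[ℝ] ℝ), (∀ x, (∀ i ∈ s, A i x ≤ 0) → γ x ≤ 0) →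
      ∃ μ : ι → ℝ, (∀ i, 0 ≤ μ i) ∧ ∀ x, γ x = ∑ i ∈ s, μ i * A i x := by
  classical
  induction s using Finset.induction_on with
  | empty =>
    intro A γ h
    refine ⟨0, fun _ => le_rfl, fun x => ?_⟩
    have h₁ := h x (by simp)
    have h₂ := h (-x) (by simp)
    rw [map_neg] at h₂
    simp
    linarith
  | insert k s hk ih =>
    intro A γ h
    by_cases hs : ∀ x, (∀ i ∈ s, A i x ≤ 0) → γ x ≤ 0
    · obtain ⟨μ, hμ, he⟩ := ih A γ hs
      refine ⟨Function.update μ k 0, fun i => ?_, fun x => ?_⟩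
      · by_cases hi : i = k
        · simp [hi]
        · simp [hi, hμ]
      · rw [Finset.sum_insert hk, he]
        simp only [Function.update_self, zero_mul, zero_add]
        refine Finset.sum_congr rfl fun i hi => ?_
        rw [Function.update_of_ne (ne_of_mem_of_not_mem hi hk)]
    -- Constraint `k` is essential: some `y` satisfies the others and has `γ y > 0`, hence `A k y >
    -- 0`. Projecting along `y` onto `ker (A k)` removes `k`; the signs at `y` make its restored
    -- multiplier nonnegative.
    · push Not at hs
      obtain ⟨y, hy, hγ⟩ := hs
      have hky : 0 < A k y := by
        by_contra hcon
        refine hγ.not_ge (h y fun i hi => ?_)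
        rcases Finset.mem_insert.1 hi with rfl | hi
        · exact not_lt.1 hcon
        · exact hy i hi
      obtain ⟨μ, hμ, he⟩ := ih (fun i => A i - (A i y / A k y) • A k)
        (γ - (γ y / A k y) • A k) fun x hx => by
          have := h (x - (A k x / A k y) • y) fun i hi => by
            rcases Finset.mem_insert.1 hi with rfl | hi
            · simp [hky.ne']
            · have := hx i hi
              simp only [LinearMap.sub_apply, LinearMap.smul_apply, smul_eq_mul, map_sub,
                map_smul] at this ⊢
              calc _ = _ := by ring
                _ ≤ 0 := this
          simp only [LinearMap.sub_apply, LinearMap.smul_apply, smul_eq_mul, map_sub,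
            map_smul] at this ⊢
          calc _ = _ := by ring
            _ ≤ 0 := this
      refine ⟨Function.update μ k (γ y / A k y - ∑ i ∈ s, μ i * (A i y / A k y)), fun i => ?_,
        fun x => ?_⟩
      · by_cases hi : i = k
        · subst hi
          simp only [Function.update_self, sub_nonneg]
          exact (Finset.sum_nonpos fun j hj => mul_nonpos_of_nonneg_of_nonpos (hμ j)
            (div_nonpos_of_nonpos_of_nonneg (hy j hj) hky.le)).trans (div_pos hγ hky).le
        · simp [hi, hμ]
      · rw [Finset.sum_insert hk]
        have := he x
        simp only [LinearMap.sub_apply, LinearMap.smul_apply, smul_eq_mul] at this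
        have h₁ : ∑ i ∈ s, Function.update μ k
            (γ y / A k y - ∑ i ∈ s, μ i * (A i y / A k y)) i * A i x = ∑ i ∈ s, μ i * A i x :=
          Finset.sum_congr rfl fun i hi => by
            rw [Function.update_of_ne (ne_of_mem_of_not_mem hi hk)]
        have h₂ : ∑ i ∈ s, μ i * (A i x - A i y / A k y * A k x) =
            ∑ i ∈ s, μ i * A i x - (∑ i ∈ s, μ i * (A i y / A k y)) * A k x := by
          rw [Finset.sum_mul, ← Finset.sum_sub_distrib]
          exact Finset.sum_congr rfl fun i _ => by ring
        rw [h₁, Function.update_self]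
        linarith

/-- The affine form of Farkas' lemma: a linear inequality that follows from a feasible finite
system of linear inequalities is dominated by a nonnegative combination of them. -/
theorem affine_farkas {ι W : Type*} [Fintype ι] [AddCommGroup W] [Module ℝ W]
    (A : ι → W →ₗ[ℝ] ℝ) (k : ι → ℝ) (γ : W →ₗ[ℝ] ℝ) (v : ℝ) (hne : ∃ x, ∀ i, A i x ≤ k i)
    (h : ∀ x, (∀ i, A i x ≤ k i) → γ x ≤ v) :
    ∃ μ : ι → ℝ, (∀ i, 0 ≤ μ i) ∧ (∀ x, γ x = ∑ i, μ i * A i x) ∧ ∑ i, μ i * k i ≤ v := by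
  obtain ⟨x₀, hx₀⟩ := hne
  -- Homogenization by a variable `τ`, with `none` encoding `τ ≥ 0`. At `τ = 0` a direction with `γ
  -- x > 0` would, followed from `x₀` until `γ = v + 1`, violate the bound.
  let B : Option ι → W × ℝ →ₗ[ℝ] ℝ := fun o => o.elim (-LinearMap.snd ℝ W ℝ)
    (fun i => A i ∘ₗ LinearMap.fst ℝ W ℝ - k i • LinearMap.snd ℝ W ℝ)
  obtain ⟨μ, hμ, he⟩ := farkas Finset.univ B
    (γ ∘ₗ LinearMap.fst ℝ W ℝ - v • LinearMap.snd ℝ W ℝ) fun p hp => by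
      obtain ⟨x, τ⟩ := p
      have hτ : 0 ≤ τ := by simpa [B] using hp none (Finset.mem_univ _)
      have hA : ∀ i, A i x ≤ k i * τ := fun i => by
        simpa [B] using hp (some i) (Finset.mem_univ _)
      suffices γ x ≤ v * τ by simpa using this
      rcases hτ.eq_or_lt with rfl | hτ
      · simp only [mul_zero] at hA ⊢
        by_contra! hcon
        have := h (x₀ + ((v - γ x₀ + 1) / γ x) • x) fun i => by
          have h₁ : 0 ≤ (v - γ x₀ + 1) / γ x :=
            div_nonneg (by linarith [h x₀ hx₀]) hcon.le
          have h₂ := mul_nonpos_of_nonneg_of_nonpos h₁ (hA i)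
          simp only [map_add, map_smul, smul_eq_mul]
          linarith [hx₀ i]
        simp only [map_add, map_smul, smul_eq_mul, div_mul_cancel₀ _ hcon.ne'] at this
        linarith
      · have := h (τ⁻¹ • x) fun i => by
          simp only [map_smul, smul_eq_mul]
          rw [inv_mul_le_iff₀ hτ, mul_comm]
          exact hA i
        simp only [map_smul, smul_eq_mul] at this
        rwa [inv_mul_le_iff₀ hτ, mul_comm] at this
  refine ⟨fun i => μ (some i), fun i => hμ _, fun x => ?_, ?_⟩
  · simpa [B, Fintype.sum_option] using he (x, 0)
  · have := he (0, 1)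
    simp [B, Fintype.sum_option] at this
    linarith [hμ none]

end Duality

/-! ### The adversary's linear program, and attainment of the extrema by compactness. -/

section LinearProgram

variable {d n : ℕ}

theorem dotProduct_exampleScore (F : Matrix (Fin d) (Fin n) ℝ) (σ : Fin d → ℝ) (z : Fin n → ℝ) :
    ∑ j, exampleScore F σ j * z j = ∑ i, σ i * F.mulVec z i := by
  have : exampleScore F σ = F.transpose.mulVec σ := rfl
  change exampleScore F σ ⬝ᵥ z = σ ⬝ᵥ F.mulVec z
  rw [this, Matrix.mulVec_transpose, Matrix.dotProduct_mulVec]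

theorem weak_duality (F : Matrix (Fin d) (Fin n) ℝ) (b : Fin d → ℝ) (w z : Fin n → ℝ)
    (hz : z ∈ feasible F b) (σ : Fin d → ℝ) (hσ : 0 ≤ σ) :
    (1 / (n : ℝ)) * ∑ j, -(w j * z j) ≤
      -(b ⬝ᵥ σ) + (1 / (n : ℝ)) * ∑ j, |exampleScore F σ j - w j| := by
  obtain ⟨⟨hz₁, hz₂⟩, hz₃⟩ := hz
  have h₁ : b ⬝ᵥ σ ≤ (1 / (n : ℝ)) * ∑ j, exampleScore F σ j * z j := by
    rw [dotProduct_exampleScore, Finset.mul_sum]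
    refine Finset.sum_le_sum fun i _ => ?_
    have := mul_le_mul_of_nonneg_right (hz₃ i) (hσ i)
    simp only [Pi.smul_apply, smul_eq_mul] at this
    linarith
  have h₂ : ∑ j, -(w j * z j) + ∑ j, -|exampleScore F σ j - w j| ≤
      -∑ j, exampleScore F σ j * z j := by
    rw [← Finset.sum_neg_distrib, ← Finset.sum_add_distrib]
    refine Finset.sum_le_sum fun j _ => ?_
    have hz : |z j| ≤ 1 := abs_le.2 ⟨hz₁ j, hz₂ j⟩
    have := (le_abs_self _).trans_eq (abs_mul (exampleScore F σ j - w j) (z j))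
    have := mul_le_mul_of_nonneg_left hz (abs_nonneg (exampleScore F σ j - w j))
    linarith
  have hn : (0 : ℝ) ≤ 1 / (n : ℝ) := by positivity
  have := mul_le_mul_of_nonneg_left h₂ hn
  rw [Finset.sum_neg_distrib (fun j => |exampleScore F σ j - w j|), mul_add] at this
  linarith

theorem strong_duality (F : Matrix (Fin d) (Fin n) ℝ) (b : Fin d → ℝ)
    (hfeas : (feasible F b).Nonempty) (hn : 0 < n) (w : Fin n → ℝ) (v : ℝ)
    (hv : ∀ z ∈ feasible F b, (1 / (n : ℝ)) * ∑ j, -(w j * z j) ≤ v) :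
    ∃ σ : Fin d → ℝ, 0 ≤ σ ∧
      -(b ⬝ᵥ σ) + (1 / (n : ℝ)) * ∑ j, |exampleScore F σ j - w j| ≤ v := by
  classical
  have hn' : (n : ℝ) ≠ 0 := by positivity
  let A : Fin d ⊕ Fin n ⊕ Fin n → (Fin n → ℝ) →ₗ[ℝ] ℝ :=
    Sum.elim (fun i => -((1 / (n : ℝ)) • (LinearMap.proj i ∘ₗ F.mulVecLin)))
      (Sum.elim (fun j => LinearMap.proj j) (fun j => -LinearMap.proj j))
  let k : Fin d ⊕ Fin n ⊕ Fin n → ℝ := Sum.elim (fun i => -b i) (fun _ => 1)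
  let γ : (Fin n → ℝ) →ₗ[ℝ] ℝ := (1 / (n : ℝ)) • ∑ j, -(w j • LinearMap.proj j)
  have hmem : ∀ z, z ∈ feasible F b ↔ ∀ o, A o z ≤ k o := fun z => by
    simp only [feasible, Set.mem_ofPred_eq, Set.mem_Icc, Pi.le_def, Sum.forall, A, k, Sum.elim_inl,
      Sum.elim_inr, LinearMap.neg_apply, LinearMap.smul_apply, LinearMap.comp_apply,
      LinearMap.proj_apply, Matrix.mulVecLin_apply, neg_le_neg_iff, Pi.smul_apply, Pi.neg_apply,
      Pi.one_apply]
    constructor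
    · rintro ⟨⟨h₁, h₂⟩, h₃⟩
      exact ⟨h₃, h₂, fun j => by linarith [h₁ j]⟩
    · rintro ⟨h₃, h₂, h₁⟩
      exact ⟨⟨fun j => by linarith [h₁ j], h₂⟩, h₃⟩
  have hγ : ∀ z, γ z = (1 / (n : ℝ)) * ∑ j, -(w j * z j) := fun z => by
    simp [γ, LinearMap.sum_apply]
  obtain ⟨μ, hμ, he, hle⟩ := affine_farkas A k γ v
    (hfeas.imp fun z hz => (hmem z).1 hz) fun z hz => by
      rw [hγ]
      exact hv z ((hmem z).2 hz)
  refine ⟨fun i => μ (Sum.inl i), fun i => hμ _, ?_⟩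
  set σ : Fin d → ℝ := fun i => μ (Sum.inl i) with hσ
  -- Comparing coefficients of `zⱼ`: the residual is the difference of the multipliers of `zⱼ ≤ 1`
  -- and `-zⱼ ≤ 1`, so its absolute value is at most their sum.
  have hcoord : ∀ j, (1 / (n : ℝ)) * (exampleScore F σ j - w j) =
      μ (Sum.inr (Sum.inl j)) - μ (Sum.inr (Sum.inr j)) := fun j => by
    have h := he (Pi.single j 1)
    have h₁ := dotProduct_exampleScore F σ (Pi.single j 1)
    have h₂ : ∑ i, μ (Sum.inl i) * -((1 / (n : ℝ)) * F.mulVec (Pi.single j 1) i) =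
        -((1 / (n : ℝ)) * ∑ i, σ i * F.mulVec (Pi.single j 1) i) := by
      rw [Finset.mul_sum, ← Finset.sum_neg_distrib]
      exact Finset.sum_congr rfl fun i _ => by rw [hσ]; ring
    rw [hγ, Fintype.sum_sum_type, Fintype.sum_sum_type] at h
    simp only [A, Sum.elim_inl, Sum.elim_inr, LinearMap.neg_apply, LinearMap.smul_apply,
      LinearMap.comp_apply, LinearMap.proj_apply, Matrix.mulVecLin_apply, smul_eq_mul] at h
    rw [h₂, ← h₁] at h
    simp only [Pi.single_apply, mul_ite, mul_one, mul_zero, mul_neg, Finset.sum_neg_distrib,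
      Finset.sum_ite_eq', Finset.mem_univ, if_true] at h
    linarith
  have habs : (1 / (n : ℝ)) * ∑ j, |exampleScore F σ j - w j| ≤
      ∑ j, (μ (Sum.inr (Sum.inl j)) + μ (Sum.inr (Sum.inr j))) := by
    rw [Finset.mul_sum]
    refine Finset.sum_le_sum fun j _ => ?_
    have hpos : (0 : ℝ) ≤ 1 / (n : ℝ) := by positivity
    rw [show 1 / (n : ℝ) * |exampleScore F σ j - w j| =
      |1 / (n : ℝ) * (exampleScore F σ j - w j)| by rw [abs_mul, abs_of_nonneg hpos], hcoord, abs_le]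
    constructor <;> linarith [hμ (Sum.inr (Sum.inl j)), hμ (Sum.inr (Sum.inr j))]
  rw [Fintype.sum_sum_type, Fintype.sum_sum_type] at hle
  simp only [k, Sum.elim_inl, Sum.elim_inr, mul_one] at hle
  have hb : ∑ i, μ (Sum.inl i) * -b i = -(b ⬝ᵥ σ) := by
    rw [dotProduct, ← Finset.sum_neg_distrib]
    exact Finset.sum_congr rfl fun i _ => by rw [hσ]; ring
  rw [hb] at hle
  rw [Finset.sum_add_distrib] at habs
  linarith

theorem two_mul_avgLoss (hn : 0 < n) (lp lm : ℝ → ℝ) (c : ℝ) (g q z : Fin n → ℝ) :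
    2 * avgLoss lp lm c g q z =
      (1 / (n : ℝ)) * ∑ j, (q j * (lp (g j) + lm (g j)) - q j * (2 * c)) +
        (1 / (n : ℝ)) * ∑ j, -(q j * score lp lm (g j) * z j) + 2 * c := by
  have hn' : (n : ℝ) ≠ 0 := by positivity
  have hc : 2 * c = (1 / (n : ℝ)) * ∑ _j : Fin n, 2 * c := by
    simp
    field_simp
  rw [hc, ← mul_add, ← mul_add, ← Finset.sum_add_distrib, ← Finset.sum_add_distrib, ← hc, avgLoss,
    mul_left_comm, Finset.mul_sum]
  congr 1
  refine Finset.sum_congr rfl fun j _ => ?_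
  rw [score]
  ring

theorem isCompact_feasible (F : Matrix (Fin d) (Fin n) ℝ) (b : Fin d → ℝ) :
    IsCompact (feasible F b) := by
  have hclosed : IsClosed {z : Fin n → ℝ | b ≤ (1 / (n : ℝ)) • F.mulVec z} :=
    isClosed_le continuous_const (by fun_prop)
  exact isCompact_Icc.inter_right hclosed

theorem continuous_avgLoss (lp lm : ℝ → ℝ) (c : ℝ) (g q : Fin n → ℝ) :
    Continuous (avgLoss lp lm c g q) := by
  unfold avgLoss
  fun_prop

theorem continuousOn_avgLoss {lp lm : ℝ → ℝ} (hloss : IsPartialLosses lp lm) (c : ℝ)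
    (z : Fin n → ℝ) :
    ContinuousOn (fun s : (Fin n → ℝ) × (Fin n → ℝ) => avgLoss lp lm c s.1 s.2 z)
      (strategies n) := by
  have hg : ∀ (j : Fin n) (l : ℝ → ℝ), ContinuousOn l (Set.Icc (-1) 1) →
      ContinuousOn (fun s : (Fin n → ℝ) × (Fin n → ℝ) => l (s.1 j)) (strategies n) :=
    fun j l hl => hl.comp (by fun_prop) fun s hs => ⟨hs.1.1 j, hs.1.2 j⟩
  have hp := fun j => hg j lp hloss.continuous_lp
  have hm := fun j => hg j lm hloss.continuous_lm
  refine continuousOn_const.mul (continuousOn_finsetSum _ fun j _ => ?_)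
  have hq : ContinuousOn (fun s : (Fin n → ℝ) × (Fin n → ℝ) => s.2 j) (strategies n) := by fun_prop
  exact (hq.mul ((continuousOn_const.mul (hp j)).add (continuousOn_const.mul (hm j)))).add
    ((continuousOn_const.sub hq).mul continuousOn_const)

theorem isGreatest_worstLoss (lp lm : ℝ → ℝ) (c : ℝ) (F : Matrix (Fin d) (Fin n) ℝ)
    (b : Fin d → ℝ) (hfeas : (feasible F b).Nonempty) (g q : Fin n → ℝ) :
    IsGreatest (avgLoss lp lm c g q '' feasible F b) (worstLoss lp lm c F b g q) :=
  ((isCompact_feasible F b).image (continuous_avgLoss lp lm c g q)).isGreatest_sSup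
    (hfeas.image _)

theorem isLeast_gameValue {lp lm : ℝ → ℝ} (hloss : IsPartialLosses lp lm) (c : ℝ)
    (F : Matrix (Fin d) (Fin n) ℝ) (b : Fin d → ℝ) (hfeas : (feasible F b).Nonempty) :
    IsLeast ((fun s => worstLoss lp lm c F b s.1 s.2) '' strategies n)
      (gameValue lp lm c F b) := by
  have hne : (strategies n).Nonempty :=
    ⟨(0, 0), ⟨by constructor <;> intro j <;> simp, by constructor <;> intro j <;> simp⟩⟩
  have hcomp : IsCompact (strategies n) := isCompact_Icc.prod isCompact_Icc
  have hlsc : LowerSemicontinuousOn (fun s => worstLoss lp lm c F b s.1 s.2) (strategies n) := by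
    have heq : (fun s : (Fin n → ℝ) × (Fin n → ℝ) => worstLoss lp lm c F b s.1 s.2) =
        fun s => ⨆ z : feasible F b, avgLoss lp lm c s.1 s.2 z := funext fun s => sSup_image'
    rw [heq]
    have hz : ∀ z : feasible F b, LowerSemicontinuousOn
        (fun s : (Fin n → ℝ) × (Fin n → ℝ) => avgLoss lp lm c s.1 s.2 (z : Fin n → ℝ))
        (strategies n) :=
      fun z => ContinuousOn.lowerSemicontinuousOn (continuousOn_avgLoss hloss c (z : Fin n → ℝ))
    refine lowerSemicontinuousOn_ciSup (fun s _ => ?_) hz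
    have := (isGreatest_worstLoss lp lm c F b hfeas s.1 s.2).bddAbove
    rwa [Set.image_eq_range] at this
  obtain ⟨s, hs, hmin⟩ := hlsc.exists_isMinOn hne hcomp
  have hl : IsLeast ((fun s => worstLoss lp lm c F b s.1 s.2) '' strategies n)
      (worstLoss lp lm c F b s.1 s.2) :=
    ⟨⟨s, hs, rfl⟩, by rintro _ ⟨s', hs', rfl⟩; exact hmin hs'⟩
  rwa [gameValue, hl.csInf_eq]

end LinearProgram

/-! ### The potential well -/

section Potential

variable {lp lm : ℝ → ℝ}

theorem IsPartialLosses.antitoneOn_Icc (h : IsPartialLosses lp lm) :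
    AntitoneOn lp (Set.Icc (-1) 1) := by
  refine antitoneOn_of_deriv_nonpos (convex_Icc _ _) h.continuous_lp ?_ ?_
  · rw [interior_Icc]
    exact h.differentiable_lp
  · rw [interior_Icc]
    intro x hx
    rw [← derivWithin_of_isOpen isOpen_Ioo hx]
    exact h.antitone_lp.derivWithin_nonpos

theorem IsPartialLosses.monotoneOn_Icc (h : IsPartialLosses lp lm) :
    MonotoneOn lm (Set.Icc (-1) 1) := by
  refine monotoneOn_of_deriv_nonneg (convex_Icc _ _) h.continuous_lm ?_ ?_
  · rw [interior_Icc]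
    exact h.differentiable_lm
  · rw [interior_Icc]
    intro x hx
    rw [← derivWithin_of_isOpen isOpen_Ioo hx]
    exact h.monotone_lm.derivWithin_nonneg

theorem IsPartialLosses.score_mono (h : IsPartialLosses lp lm) :
    MonotoneOn (score lp lm) (Set.Icc (-1) 1) := fun _ hx _ hy hxy =>
  sub_le_sub (h.monotoneOn_Icc hx hy hxy) (h.antitoneOn_Icc hx hy hxy)

theorem IsPartialLosses.score_continuousOn (h : IsPartialLosses lp lm) :
    ContinuousOn (score lp lm) (Set.Icc (-1) 1) :=
  h.continuous_lm.sub h.continuous_lp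

theorem IsPartialLosses.score_left_le (h : IsPartialLosses lp lm) :
    score lp lm (-1) ≤ score lp lm 1 :=
  h.score_mono (by norm_num) (by norm_num) (by norm_num)

/-- `Γ` is a sum of the nondecreasing functions `ℓ₋` and `-ℓ₊`, so if it agrees at two points, each
summand does. Hence `Ψ` does not depend on the choice of preimage in `Γ⁻¹`. -/
theorem IsPartialLosses.eq_of_score_eq (h : IsPartialLosses lp lm) {g g' : ℝ}
    (hg : g ∈ Set.Icc (-1 : ℝ) 1) (hg' : g' ∈ Set.Icc (-1 : ℝ) 1)
    (he : score lp lm g = score lp lm g') : lp g = lp g' ∧ lm g = lm g' := by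
  unfold score at he
  rcases le_total g g' with hle | hle
  · have h₁ := h.monotoneOn_Icc hg hg' hle
    have h₂ := h.antitoneOn_Icc hg hg' hle
    constructor <;> linarith
  · have h₁ := h.monotoneOn_Icc hg' hg hle
    have h₂ := h.antitoneOn_Icc hg' hg hle
    constructor <;> linarith

theorem IsPartialLosses.scoreInv_spec (h : IsPartialLosses lp lm) {m : ℝ}
    (h₁ : score lp lm (-1) ≤ m) (h₂ : m ≤ score lp lm 1) :
    scoreInv lp lm m ∈ Set.Icc (-1 : ℝ) 1 ∧ score lp lm (scoreInv lp lm m) = m := by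
  have hne : {g : ℝ | g ∈ Set.Icc (-1) 1 ∧ score lp lm g = m}.Nonempty :=
    intermediate_value_Icc (by norm_num) h.score_continuousOn ⟨h₁, h₂⟩
  have hclosed : IsClosed {g : ℝ | g ∈ Set.Icc (-1) 1 ∧ score lp lm g = m} :=
    h.score_continuousOn.preimage_isClosed_of_isClosed isClosed_Icc (isClosed_singleton (x := m))
  exact hclosed.csInf_mem hne ⟨-1, fun g hg => hg.1.1⟩

theorem IsPartialLosses.potential_score (h : IsPartialLosses lp lm) {g : ℝ}
    (hg : g ∈ Set.Icc (-1 : ℝ) 1) : potential lp lm (score lp lm g) = lp g + lm g := by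
  have hl : (-1 : ℝ) ∈ Set.Icc (-1 : ℝ) 1 := by norm_num
  have hr : (1 : ℝ) ∈ Set.Icc (-1 : ℝ) 1 := by norm_num
  unfold potential
  split_ifs with h₁ h₂
  · have he := h₁.antisymm (h.score_mono hl hg hg.1)
    obtain ⟨h₃, h₄⟩ := h.eq_of_score_eq hg hl he
    rw [he, score, h₃, h₄]
    ring
  · have he := h₂.antisymm (h.score_mono hg hr hg.2)
    obtain ⟨h₃, h₄⟩ := h.eq_of_score_eq hr hg he
    rw [← he, score, h₃, h₄]
    ring
  · obtain ⟨h₃, h₄⟩ := h.scoreInv_spec (not_le.1 h₁).le (not_le.1 h₂).le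
    obtain ⟨h₅, h₆⟩ := h.eq_of_score_eq h₃ hg h₄
    rw [h₅, h₆]

theorem deriv_potential_of_lt {x : ℝ} (hx : x < score lp lm (-1)) :
    deriv (potential lp lm) x = -1 := by
  have he : potential lp lm =ᶠ[nhds x] fun m => -m + 2 * lm (-1) := by
    filter_upwards [gt_mem_nhds hx] with m hm
    rw [potential, if_pos hm.le]
  rw [he.deriv_eq, deriv_add_const]
  exact deriv_neg x

theorem IsPartialLosses.deriv_potential_of_gt (h : IsPartialLosses lp lm) {x : ℝ}
    (hx : score lp lm 1 < x) : deriv (potential lp lm) x = 1 := by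
  have he : potential lp lm =ᶠ[nhds x] fun m => m + 2 * lp 1 := by
    filter_upwards [lt_mem_nhds hx] with m hm
    rw [potential, if_neg (h.score_left_le.trans_lt hm).not_ge, if_pos hm.le]
  rw [he.deriv_eq, deriv_add_const]
  exact deriv_id x

theorem IsPartialLosses.abs_deriv_potential_le (h : IsPartialLosses lp lm)
    (hconv : ConvexOn ℝ Set.univ (potential lp lm)) (hdiff : Differentiable ℝ (potential lp lm))
    (x : ℝ) : |deriv (potential lp lm) x| ≤ 1 := by
  have hm := ConvexOn.monotone_deriv hconv hdiff
  rw [abs_le]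
  constructor
  · have : min x (score lp lm (-1)) - 1 < score lp lm (-1) := by
      linarith [min_le_right x (score lp lm (-1))]
    rw [← deriv_potential_of_lt this]
    exact hm (by linarith [min_le_left x (score lp lm (-1))])
  · have : score lp lm 1 < max x (score lp lm 1) + 1 := by
      linarith [le_max_right x (score lp lm 1)]
    rw [← h.deriv_potential_of_gt this]
    exact hm (by linarith [le_max_left x (score lp lm 1)])

theorem IsPartialLosses.continuous_phi (h : IsPartialLosses lp lm)
    (hconv : ConvexOn ℝ Set.univ (potential lp lm)) (hdiff : Differentiable ℝ (potential lp lm)) :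
    Continuous (phi lp lm) :=
  hdiff.continuous.sub (continuous_id.mul (ConvexOn.continuous_deriv_of_abs_le_one hconv hdiff
    (h.abs_deriv_potential_le hconv hdiff)))

theorem phi_le_phi (hconv : ConvexOn ℝ Set.univ (potential lp lm))
    (hdiff : Differentiable ℝ (potential lp lm)) {x y : ℝ} (h : 0 ≤ x * (y - x)) :
    phi lp lm y ≤ phi lp lm x :=
  ConvexOn.tangent_intercept_le hconv hdiff h

theorem K_eq_phi (s q : ℝ) : K lp lm s q = phi lp lm (s / q) := rfl

theorem phi_div_mono (hconv : ConvexOn ℝ Set.univ (potential lp lm))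
    (hdiff : Differentiable ℝ (potential lp lm)) (s : ℝ) {q q' : ℝ} (hq : 0 < q) (h : q ≤ q') :
    phi lp lm (s / q) ≤ phi lp lm (s / q') := by
  refine phi_le_phi hconv hdiff ?_
  have hq' := hq.trans_le h
  have : s / q' * (s / q - s / q') = s ^ 2 * (q' - q) / (q' ^ 2 * q) := by
    field_simp
  rw [this]
  exact div_nonneg (mul_nonneg (sq_nonneg s) (sub_nonneg.2 h)) (by positivity)

theorem deriv_potential_eq_of_phi_eq (hconv : ConvexOn ℝ Set.univ (potential lp lm))
    (hdiff : Differentiable ℝ (potential lp lm)) {s x y : ℝ} (hs : s ≠ 0) (hx : 0 ≤ x * s)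
    (hy : 0 ≤ y * s) (he : phi lp lm x = phi lp lm y) :
    deriv (potential lp lm) x = deriv (potential lp lm) y := by
  have key : 0 ≤ x * (y - x) ∨ 0 ≤ y * (x - y) := by
    rcases hs.lt_or_gt with hs | hs
    · have hx := nonpos_of_mul_nonneg_left hx hs
      have hy := nonpos_of_mul_nonneg_left hy hs
      rcases le_total x y with h | h
      · exact Or.inr (mul_nonneg_of_nonpos_of_nonpos hy (sub_nonpos.2 h))
      · exact Or.inl (mul_nonneg_of_nonpos_of_nonpos hx (sub_nonpos.2 h))
    · have hx := nonneg_of_mul_nonneg_left hx hs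
      have hy := nonneg_of_mul_nonneg_left hy hs
      rcases le_total x y with h | h
      · exact Or.inl (mul_nonneg hx (sub_nonneg.2 h))
      · exact Or.inr (mul_nonneg hy (sub_nonneg.2 h))
  rcases key with h | h
  · exact ConvexOn.deriv_eq_of_tangent_intercept_eq hconv hdiff h he
  · exact (ConvexOn.deriv_eq_of_tangent_intercept_eq hconv hdiff h he.symm).symm

/-- Far out on the ray through `s`, the potential well has slope `sgn s`. -/
theorem IsPartialLosses.exists_far (h : IsPartialLosses lp lm) {s x : ℝ} (hs : s ≠ 0)
    (hx : 0 ≤ x * s) :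
    ∃ y, 0 < y * s ∧ 0 ≤ x * (y - x) ∧ deriv (potential lp lm) y * s = |s| := by
  rcases hs.lt_or_gt with hs | hs
  · have hx := nonpos_of_mul_nonneg_left hx hs
    have h₁ := min_le_left x (score lp lm (-1))
    have h₂ := min_le_right x (score lp lm (-1))
    refine ⟨min x (score lp lm (-1)) - 1, ?_, ?_, ?_⟩
    · exact mul_pos_of_neg_of_neg (by linarith) hs
    · exact mul_nonneg_of_nonpos_of_nonpos hx (by linarith)
    · rw [deriv_potential_of_lt (by linarith), abs_of_neg hs]
      ring
  · have hx := nonneg_of_mul_nonneg_left hx hs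
    have h₁ := le_max_left x (score lp lm 1)
    have h₂ := le_max_right x (score lp lm 1)
    refine ⟨max x (score lp lm 1) + 1, ?_, ?_, ?_⟩
    · exact mul_pos (by linarith) hs
    · exact mul_nonneg hx (by linarith)
    · rw [h.deriv_potential_of_gt (by linarith), abs_of_pos hs]
      ring

/-- Every tangent of the potential well bounds the dual loss from below. -/
theorem IsPartialLosses.tangent_le_dualLoss (h : IsPartialLosses lp lm)
    (hconv : ConvexOn ℝ Set.univ (potential lp lm)) (hdiff : Differentiable ℝ (potential lp lm))
    (s y : ℝ) {q g : ℝ} (hq : 0 ≤ q) (hg : g ∈ Set.Icc (-1 : ℝ) 1) :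
    q * phi lp lm y + deriv (potential lp lm) y * s ≤
      q * (lp g + lm g) + |s - q * score lp lm g| := by
  -- The tangent inequality at `Γ(g)`, scaled by `q`, leaves `Ψ'(y)(s - q Γ(g))`, which the absolute
  -- value absorbs because `|Ψ'| ≤ 1`.
  have h₁ := mul_le_mul_of_nonneg_left
    (ConvexOn.tangent_le hconv hdiff (score lp lm g) y) hq
  have h₂ := (le_abs_self _).trans_eq
    (abs_mul (deriv (potential lp lm) y) (s - q * score lp lm g))
  have h₃ := mul_le_mul_of_nonneg_right (h.abs_deriv_potential_le hconv hdiff y)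
    (abs_nonneg (s - q * score lp lm g))
  rw [h.potential_score hg] at h₁
  unfold phi
  linarith

theorem IsPartialLosses.optPred_mem (h : IsPartialLosses lp lm) {q : ℝ} (hq : 0 ≤ q) (s : ℝ) :
    optPred lp lm q s ∈ Set.Icc (-1 : ℝ) 1 := by
  unfold optPred
  split_ifs with h₁ h₂
  · norm_num
  · norm_num
  · rw [not_le] at h₁ h₂
    rcases hq.eq_or_lt with rfl | hq
    · linarith
    · refine (h.scoreInv_spec ?_ ?_).1
      · rw [le_div_iff₀ hq]; linarith
      · rw [div_le_iff₀ hq]; linarith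

/-- In the middle case `q Γ(g) = s` and the absolute value vanishes; in the outer cases its sign is
fixed and it supplies the slope `±1` of the affine branches of `Ψ`. -/
theorem IsPartialLosses.dualLoss_optPred (h : IsPartialLosses lp lm) {q : ℝ} (hq : 0 < q) (s : ℝ) :
    q * (lp (optPred lp lm q s) + lm (optPred lp lm q s)) +
      |s - q * score lp lm (optPred lp lm q s)| = q * potential lp lm (s / q) := by
  have hiff₁ : s / q ≤ score lp lm (-1) ↔ s ≤ q * score lp lm (-1) := by
    rw [div_le_iff₀ hq, mul_comm]
  have hiff₂ : score lp lm 1 ≤ s / q ↔ q * score lp lm 1 ≤ s := by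
    rw [le_div_iff₀ hq, mul_comm]
  unfold optPred potential
  simp only [hiff₁, hiff₂]
  split_ifs with h₁ h₂
  · rw [abs_of_nonpos (by linarith), score]
    field_simp
    ring
  · rw [abs_of_nonneg (by linarith), score]
    field_simp
    ring
  · have := (h.scoreInv_spec (not_le.1 (hiff₁.not.2 h₁)).le (not_le.1 (hiff₂.not.2 h₂)).le).2
    rw [this, mul_div_cancel₀ _ hq.ne']
    simp

end Potential

/-! ### The abstaining potential well -/

section AbstainingWell

theorem ereal_coe_sInf {S : Set ℝ} (hne : S.Nonempty) (hb : BddBelow S) :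
    sInf ((fun x : ℝ => (x : EReal)) '' S) = ((sInf S : ℝ) : EReal) :=
  (Monotone.map_csInf_of_continuousAt (f := fun x : ℝ => (x : EReal))
    continuous_coe_real_ereal.continuousAt
    (fun _ _ h => EReal.coe_le_coe_iff.2 h) hne hb).symm

theorem ereal_coe_sSup {S : Set ℝ} (hne : S.Nonempty) (hb : BddAbove S) :
    sSup ((fun x : ℝ => (x : EReal)) '' S) = ((sSup S : ℝ) : EReal) :=
  (Monotone.map_csSup_of_continuousAt (f := fun x : ℝ => (x : EReal))
    continuous_coe_real_ereal.continuousAt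
    (fun _ _ h => EReal.coe_le_coe_iff.2 h) hne hb).symm

variable {lp lm : ℝ → ℝ}

theorem slope_coe (x : ℝ) : slope lp lm (x : EReal) = deriv (potential lp lm) x := by
  simp [slope]

/-- The bound `t ≤ φ(s)` matters only through `φ(s) ≤ φ(0)`: it settles an infimum equal to `0`. At
a positive infimum, continuity of `φ` from the left does. -/
theorem IsPartialLosses.phiInvPos_spec (h : IsPartialLosses lp lm)
    (hconv : ConvexOn ℝ Set.univ (potential lp lm)) (hdiff : Differentiable ℝ (potential lp lm))
    {s t : ℝ} (ht : t ≤ phi lp lm s) :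
    (∃ x : ℝ, 0 ≤ x ∧ phi lp lm x = t ∧ phiInvPos lp lm t = x) ∨
      (phiInvPos lp lm t = ⊤ ∧ ∀ x, 0 ≤ x → t < phi lp lm x) := by
  have hc := h.continuous_phi hconv hdiff
  rcases Set.eq_empty_or_nonempty {x : ℝ | 0 ≤ x ∧ phi lp lm x ≤ t} with he | hne
  · refine Or.inr ⟨by rw [phiInvPos, he]; simp, fun x hx => ?_⟩
    by_contra! hcon
    exact Set.eq_empty_iff_forall_notMem.1 he x ⟨hx, hcon⟩
  · have hb : BddBelow {x : ℝ | 0 ≤ x ∧ phi lp lm x ≤ t} := ⟨0, fun x hx => hx.1⟩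
    have hclosed : IsClosed {x : ℝ | 0 ≤ x ∧ phi lp lm x ≤ t} :=
      isClosed_Ici.inter (isClosed_le hc continuous_const)
    obtain ⟨h₀, h₁⟩ := hclosed.csInf_mem hne hb
    refine Or.inl ⟨_, h₀, h₁.antisymm ?_, ereal_coe_sInf hne hb⟩
    rcases h₀.eq_or_lt with hz | hpos
    · rw [← hz]
      exact ht.trans (phi_le_phi hconv hdiff (by simp))
    · refine ge_of_tendsto (hc.continuousAt.tendsto.mono_left nhdsWithin_le_nhds)
        (Filter.mem_of_superset (Ioo_mem_nhdsLT hpos) fun x hx => ?_)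
      by_contra! hcon
      exact notMem_of_lt_csInf hx.2 hb ⟨hx.1.le, le_of_lt (not_le.1 hcon)⟩

theorem IsPartialLosses.phiInvNeg_spec (h : IsPartialLosses lp lm)
    (hconv : ConvexOn ℝ Set.univ (potential lp lm)) (hdiff : Differentiable ℝ (potential lp lm))
    {s t : ℝ} (ht : t ≤ phi lp lm s) :
    (∃ x : ℝ, x ≤ 0 ∧ phi lp lm x = t ∧ phiInvNeg lp lm t = x) ∨
      (phiInvNeg lp lm t = ⊥ ∧ ∀ x, x < 0 → t < phi lp lm x) := by
  have hc := h.continuous_phi hconv hdiff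
  rcases Set.eq_empty_or_nonempty {x : ℝ | x < 0 ∧ phi lp lm x ≤ t} with he | hne
  · refine Or.inr ⟨by rw [phiInvNeg, he]; simp, fun x hx => ?_⟩
    by_contra! hcon
    exact Set.eq_empty_iff_forall_notMem.1 he x ⟨hx, hcon⟩
  · have hb : BddAbove {x : ℝ | x < 0 ∧ phi lp lm x ≤ t} := ⟨0, fun x hx => hx.1.le⟩
    have hclosed : IsClosed {x : ℝ | x ≤ 0 ∧ phi lp lm x ≤ t} :=
      isClosed_Iic.inter (isClosed_le hc continuous_const)
    have hsub : {x : ℝ | x < 0 ∧ phi lp lm x ≤ t} ⊆ {x : ℝ | x ≤ 0 ∧ phi lp lm x ≤ t} :=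
      fun x hx => ⟨le_of_lt hx.1, hx.2⟩
    obtain ⟨h₀, h₁⟩ := closure_minimal hsub hclosed (csSup_mem_closure hne hb)
    refine Or.inl ⟨_, h₀, h₁.antisymm ?_, ereal_coe_sSup hne hb⟩
    rcases h₀.eq_or_lt with hz | hneg
    · rw [hz]
      exact ht.trans (phi_le_phi hconv hdiff (by simp))
    · refine ge_of_tendsto (hc.continuousAt.tendsto.mono_left nhdsWithin_le_nhds)
        (Filter.mem_of_superset (Ioo_mem_nhdsGT hneg) fun x hx => ?_)
      by_contra! hcon
      exact notMem_of_csSup_lt hx.1 hb ⟨hx.2, le_of_lt (not_le.1 hcon)⟩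

theorem Q_of_lt {s t : ℝ} (ht : phi lp lm s < t) : Q lp lm s t = potential lp lm s - t := by
  rw [Q, if_neg]
  rwa [K_eq_phi, div_one, not_le]

/-- Either `φ` takes the value `t` on the closed ray through `s`, or it stays above `t` on the open
ray and the slope is the limit `sgn s`. -/
theorem IsPartialLosses.Q_spec (h : IsPartialLosses lp lm)
    (hconv : ConvexOn ℝ Set.univ (potential lp lm)) (hdiff : Differentiable ℝ (potential lp lm))
    {s t : ℝ} (ht : t ≤ phi lp lm s) :
    (∃ x, 0 ≤ x * s ∧ phi lp lm x = t ∧ Q lp lm s t = s * deriv (potential lp lm) x) ∨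
      (Q lp lm s t = |s| ∧ ∀ x, 0 < x * s → t < phi lp lm x) := by
  have hQ : t ≤ K lp lm s 1 := by rwa [K_eq_phi, div_one]
  rw [Q, if_pos hQ]
  split_ifs with hs
  · rcases h.phiInvPos_spec hconv hdiff ht with ⟨x, hx, hφ, he⟩ | ⟨he, hφ⟩
    · exact Or.inl ⟨x, mul_nonneg hx hs, hφ, by rw [he, slope_coe]⟩
    · exact Or.inr ⟨by simp [he, slope, abs_of_nonneg hs],
        fun x hx => hφ x (pos_of_mul_pos_left hx hs).le⟩
  · rw [not_le] at hs
    rcases h.phiInvNeg_spec hconv hdiff ht with ⟨x, hx, hφ, he⟩ | ⟨he, hφ⟩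
    · exact Or.inl ⟨x, mul_nonneg_of_nonpos_of_nonpos hx hs.le, hφ, by rw [he, slope_coe]⟩
    · exact Or.inr ⟨by simp [he, slope, abs_of_neg hs],
        fun x hx => hφ x (neg_of_mul_pos_left hx hs.le)⟩

theorem optProb_mem (c s : ℝ) : optProb lp lm c s ∈ Set.Icc (0 : ℝ) 1 := by
  have h₀ : (0 : EReal) ≤ min 1 (KInv lp lm s (2 * c)) := by
    refine le_min zero_le_one (le_sInf ?_)
    rintro _ ⟨q, hq, rfl⟩
    exact EReal.coe_nonneg.2 hq.1.le
  refine ⟨EReal.toReal_nonneg h₀, ?_⟩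
  have := EReal.toReal_le_toReal (min_le_left 1 (KInv lp lm s (2 * c)))
    (ne_bot_of_le_ne_bot EReal.zero_ne_bot h₀) (EReal.coe_ne_top 1)
  simpa [optProb] using this

theorem optProb_of_lt (hconv : ConvexOn ℝ Set.univ (potential lp lm))
    (hdiff : Differentiable ℝ (potential lp lm)) {c s : ℝ} (ht : phi lp lm s < 2 * c) :
    optProb lp lm c s = 1 := by
  have : (1 : EReal) ≤ KInv lp lm s (2 * c) := by
    refine le_sInf ?_
    rintro _ ⟨q, ⟨hq, hK⟩, rfl⟩
    by_contra! hcon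
    have hq1 : q < 1 := by exact_mod_cast hcon
    have := phi_div_mono hconv hdiff s hq hq1.le
    rw [div_one] at this
    rw [K_eq_phi] at hK
    linarith
  rw [optProb, min_eq_left this]
  simp

theorem IsPartialLosses.optProb_spec (h : IsPartialLosses lp lm)
    (hconv : ConvexOn ℝ Set.univ (potential lp lm)) (hdiff : Differentiable ℝ (potential lp lm))
    {c s : ℝ} (ht : 2 * c ≤ phi lp lm s) :
    (0 < optProb lp lm c s ∧ phi lp lm (s / optProb lp lm c s) = 2 * c) ∨
      (optProb lp lm c s = 0 ∧ ∀ y, 0 < y * s → 2 * c ≤ phi lp lm y) := by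
  have hc := h.continuous_phi hconv hdiff
  set T : Set ℝ := {q : ℝ | 0 < q ∧ 2 * c ≤ K lp lm s q} with hT
  have h1 : (1 : ℝ) ∈ T := ⟨one_pos, by rwa [K_eq_phi, div_one]⟩
  have hb : BddBelow T := ⟨0, fun q hq => hq.1.le⟩
  have hr1 : sInf T ≤ 1 := csInf_le hb h1
  have he : optProb lp lm c s = sInf T := by
    have : KInv lp lm s (2 * c) = ((sInf T : ℝ) : EReal) := ereal_coe_sInf ⟨1, h1⟩ hb
    rw [optProb, this, min_eq_right (by exact_mod_cast hr1), EReal.toReal_coe]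
  have hr0 : 0 ≤ sInf T := le_csInf ⟨1, h1⟩ fun q hq => hq.1.le
  have hup : ∀ q, sInf T < q → 2 * c ≤ phi lp lm (s / q) := fun q hq => by
    obtain ⟨q', hq', hlt⟩ := exists_lt_of_csInf_lt ⟨1, h1⟩ hq
    exact hq'.2.trans (phi_div_mono hconv hdiff s hq'.1 hlt.le)
  rw [he]
  rcases hr0.eq_or_lt with hz | hpos
  -- With infimum `0`, `K ≥ 2c` at every `q > 0`, and `q = s / y` sweeps the open ray.
  · refine Or.inr ⟨hz.symm, fun y hy => ?_⟩
    have hy0 : y ≠ 0 := by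
      rintro rfl
      simp at hy
    have hs0 : s ≠ 0 := by
      rintro rfl
      simp at hy
    have := hup (s / y) (by
      rw [← hz, show s / y = y * s / y ^ 2 by field_simp]
      positivity)
    rwa [div_div_cancel₀ hs0] at this
  · have hcont : Filter.Tendsto (fun q => phi lp lm (s / q)) (nhds (sInf T))
        (nhds (phi lp lm (s / sInf T))) :=
      (hc.tendsto _).comp (continuousAt_const.div continuousAt_id hpos.ne')
    refine Or.inl ⟨hpos, le_antisymm ?_ ?_⟩
    · refine le_of_tendsto (hcont.mono_left nhdsWithin_le_nhds)
        (Filter.mem_of_superset (Ioo_mem_nhdsLT hpos) fun q hq => ?_)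
      by_contra! hcon
      exact notMem_of_lt_csInf hq.2 hb ⟨hq.1, le_of_lt (not_le.1 hcon)⟩
    · exact ge_of_tendsto (hcont.mono_left nhdsWithin_le_nhds)
        (Filter.mem_of_superset (self_mem_nhdsWithin (s := Set.Ioi (sInf T))) hup)

theorem IsPartialLosses.Q_le_dualLoss (h : IsPartialLosses lp lm)
    (hconv : ConvexOn ℝ Set.univ (potential lp lm)) (hdiff : Differentiable ℝ (potential lp lm))
    (s t : ℝ) {q g : ℝ} (hq : q ∈ Set.Icc (0 : ℝ) 1) (hg : g ∈ Set.Icc (-1 : ℝ) 1) :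
    Q lp lm s t ≤ q * (lp g + lm g) + |s - q * score lp lm g| - q * t := by
  have htan := fun y => h.tangent_le_dualLoss hconv hdiff s y hq.1 hg
  rcases lt_or_ge (phi lp lm s) t with ht | ht
  · rw [Q_of_lt ht]
    have h₁ := mul_nonneg (sub_nonneg.2 hq.2) (sub_nonneg.2 ht.le)
    have h₂ := htan s
    have h₃ : phi lp lm s = potential lp lm s - s * deriv (potential lp lm) s := rfl
    -- Tangent at `s` itself; the defect is `(1 - q)(t - φ(s)) ≥ 0`.
    linarith
  · rcases h.Q_spec hconv hdiff ht with ⟨x, _, hφ, he⟩ | ⟨he, hφ⟩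
    · have := htan x
      rw [hφ] at this
      rw [he]
      linarith
    · rw [he]
      by_cases hs : s = 0
      · subst hs
        have h₁ := htan 0
        have h₂ := mul_le_mul_of_nonneg_left ht hq.1
        rw [abs_zero]
        linarith
      -- Here `φ > t` along the whole ray, so a far tangent of slope `sgn s` already gives `|s|`.
      · obtain ⟨y, hy, _, hder⟩ := h.exists_far (x := 0) hs (by simp)
        have h₁ := htan y
        have h₂ := mul_le_mul_of_nonneg_left (hφ y hy).le hq.1
        linarith

theorem IsPartialLosses.dualLoss_opt (h : IsPartialLosses lp lm)
    (hconv : ConvexOn ℝ Set.univ (potential lp lm)) (hdiff : Differentiable ℝ (potential lp lm))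
    (c s : ℝ) {q g : ℝ} (hq : q = optProb lp lm c s) (hg : g = optPred lp lm q s) :
    q * (lp g + lm g) + |s - q * score lp lm g| - q * (2 * c) = Q lp lm s (2 * c) := by
  have hφdef : ∀ y, phi lp lm y = potential lp lm y - y * deriv (potential lp lm) y := fun _ => rfl
  rcases lt_or_ge (phi lp lm s) (2 * c) with ht | ht
  · rw [optProb_of_lt hconv hdiff ht] at hq
    subst hq hg
    rw [Q_of_lt ht, h.dualLoss_optPred one_pos, div_one]
    ring
  · rcases h.optProb_spec hconv hdiff ht with ⟨hpos, hφ⟩ | ⟨hzero, hφ⟩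
    · rw [← hq] at hpos hφ
      subst hg
      have hys : 0 ≤ s / q * s := by
        rw [div_mul_eq_mul_div]
        exact div_nonneg (mul_self_nonneg s) hpos.le
      have hval : q * potential lp lm (s / q) - q * (2 * c) =
          s * deriv (potential lp lm) (s / q) := by
        rw [← hφ, hφdef]
        field_simp
        ring
      rw [h.dualLoss_optPred hpos, hval]
      by_cases hs : s = 0
      · rcases h.Q_spec hconv hdiff ht with ⟨x, _, _, he⟩ | ⟨he, _⟩ <;> rw [he] <;> simp [hs]
      · rcases h.Q_spec hconv hdiff ht with ⟨x, hx, hφx, he⟩ | ⟨he, hlt⟩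
        · rw [he, deriv_potential_eq_of_phi_eq hconv hdiff hs hx hys (hφx.trans hφ.symm)]
        · refine absurd hφ (hlt (s / q) ?_).ne'
          rw [div_mul_eq_mul_div]
          exact div_pos (mul_self_pos.2 hs) hpos
    · rw [hq, hzero]
      simp only [zero_mul, zero_add, sub_zero]
      rcases h.Q_spec hconv hdiff ht with ⟨x, hx, hφx, he⟩ | ⟨he, _⟩
      · by_cases hs : s = 0
        · rw [he]
          simp [hs]
        -- At `q = 0` the loss is `|s|`. Beyond `x`, `φ` cannot rise, and it never drops below `2c =
        -- φ(x)`; so a far `y` has the same `φ`, and `Ψ'(x) = Ψ'(y) = sgn s`.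
        · obtain ⟨y, hy, hxy, hder⟩ := h.exists_far hs hx
          have : phi lp lm x = phi lp lm y :=
            (hφx.trans_le (hφ y hy)).antisymm (phi_le_phi hconv hdiff hxy)
          rw [he, deriv_potential_eq_of_phi_eq hconv hdiff hs hx hy.le this, mul_comm, hder]
      · exact he.symm

end AbstainingWell

/-! ### The value of the game -/

section Value

variable {d n : ℕ} {lp lm : ℝ → ℝ}

/-- The dual upper bound on twice the worst-case loss less the abstention cost. -/
noncomputable def dualLoss (lp lm : ℝ → ℝ) (F : Matrix (Fin d) (Fin n) ℝ) (b : Fin d → ℝ) (t : ℝ)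
    (g q : Fin n → ℝ) (σ : Fin d → ℝ) : ℝ :=
  -(b ⬝ᵥ σ) + (1 / (n : ℝ)) * ∑ j, (q j * (lp (g j) + lm (g j)) +
    |exampleScore F σ j - q j * score lp lm (g j)| - q j * t)

theorem dualLoss_eq (F : Matrix (Fin d) (Fin n) ℝ) (b : Fin d → ℝ) (t : ℝ)
    (g q : Fin n → ℝ) (σ : Fin d → ℝ) :
    dualLoss lp lm F b t g q σ =
      (1 / (n : ℝ)) * ∑ j, (q j * (lp (g j) + lm (g j)) - q j * t) +
      (-(b ⬝ᵥ σ) + (1 / (n : ℝ)) * ∑ j, |exampleScore F σ j - q j * score lp lm (g j)|) := by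
  rw [add_left_comm, ← mul_add, ← Finset.sum_add_distrib, dualLoss]
  congr 2
  exact Finset.sum_congr rfl fun j _ => by ring

theorem two_mul_worstLoss_le (hn : 0 < n) (F : Matrix (Fin d) (Fin n) ℝ) (b : Fin d → ℝ)
    (hfeas : (feasible F b).Nonempty) (c : ℝ) (g q : Fin n → ℝ) (σ : Fin d → ℝ) (hσ : 0 ≤ σ) :
    2 * worstLoss lp lm c F b g q ≤ dualLoss lp lm F b (2 * c) g q σ + 2 * c := by
  obtain ⟨z, hz, he⟩ := (isGreatest_worstLoss lp lm c F b hfeas g q).1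
  rw [← he, two_mul_avgLoss hn, dualLoss_eq]
  have := weak_duality F b (fun j => q j * score lp lm (g j)) z hz σ hσ
  linarith

theorem exists_dualLoss_le (hn : 0 < n) (F : Matrix (Fin d) (Fin n) ℝ) (b : Fin d → ℝ)
    (hfeas : (feasible F b).Nonempty) (c : ℝ) (g q : Fin n → ℝ) :
    ∃ σ : Fin d → ℝ, 0 ≤ σ ∧
      dualLoss lp lm F b (2 * c) g q σ + 2 * c ≤ 2 * worstLoss lp lm c F b g q := by
  obtain ⟨σ, hσ, hle⟩ := strong_duality F b hfeas hn (fun j => q j * score lp lm (g j))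
    (2 * worstLoss lp lm c F b g q - 2 * c -
      (1 / (n : ℝ)) * ∑ j, (q j * (lp (g j) + lm (g j)) - q j * (2 * c))) fun z hz => by
        have h₁ := (isGreatest_worstLoss lp lm c F b hfeas g q).2 ⟨z, hz, rfl⟩
        have h₂ := two_mul_avgLoss hn lp lm c g q z
        linarith
  refine ⟨σ, hσ, ?_⟩
  rw [dualLoss_eq]
  linarith

theorem IsPartialLosses.slack_le_dualLoss (h : IsPartialLosses lp lm)
    (hconv : ConvexOn ℝ Set.univ (potential lp lm)) (hdiff : Differentiable ℝ (potential lp lm))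
    (F : Matrix (Fin d) (Fin n) ℝ) (b : Fin d → ℝ) (t : ℝ) {g q : Fin n → ℝ}
    (hs : (g, q) ∈ strategies n) (σ : Fin d → ℝ) :
    slack lp lm F b t σ ≤ dualLoss lp lm F b t g q σ := by
  have hn : (0 : ℝ) ≤ 1 / (n : ℝ) := by positivity
  exact add_le_add_right (mul_le_mul_of_nonneg_left (Finset.sum_le_sum fun j _ =>
    h.Q_le_dualLoss hconv hdiff _ t ⟨hs.2.1 j, hs.2.2 j⟩ ⟨hs.1.1 j, hs.1.2 j⟩) hn) _

theorem IsPartialLosses.dualLoss_eq_slack (h : IsPartialLosses lp lm)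
    (hconv : ConvexOn ℝ Set.univ (potential lp lm)) (hdiff : Differentiable ℝ (potential lp lm))
    (F : Matrix (Fin d) (Fin n) ℝ) (b : Fin d → ℝ) (c : ℝ) (σ : Fin d → ℝ) {g q : Fin n → ℝ}
    (hq : ∀ j, q j = optProb lp lm c (exampleScore F σ j))
    (hg : ∀ j, g j = optPred lp lm (q j) (exampleScore F σ j)) :
    dualLoss lp lm F b (2 * c) g q σ = slack lp lm F b (2 * c) σ := by
  rw [dualLoss, slack]
  congr 2
  exact Finset.sum_congr rfl fun j _ => h.dualLoss_opt hconv hdiff c _ (hq j) (hg j)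

theorem IsPartialLosses.opt_mem_strategies (h : IsPartialLosses lp lm)
    (F : Matrix (Fin d) (Fin n) ℝ) (c : ℝ) (σ : Fin d → ℝ) {g q : Fin n → ℝ}
    (hq : ∀ j, q j = optProb lp lm c (exampleScore F σ j))
    (hg : ∀ j, g j = optPred lp lm (q j) (exampleScore F σ j)) : (g, q) ∈ strategies n := by
  have hq' : ∀ j, q j ∈ Set.Icc (0 : ℝ) 1 := fun j => by
    rw [hq]
    exact optProb_mem c _
  have hg' : ∀ j, g j ∈ Set.Icc (-1 : ℝ) 1 := fun j => by
    rw [hg]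
    exact h.optPred_mem (hq' j).1 _
  exact ⟨⟨fun j => (hg' j).1, fun j => (hg' j).2⟩, ⟨fun j => (hq' j).1, fun j => (hq' j).2⟩⟩

end Value

end AbstainGame

theorem mainTheorem5 {d n : ℕ} (hn : 0 < n)
    (F : Matrix (Fin d) (Fin n) ℝ) (b : Fin d → ℝ)
    (hfeas : (AbstainGame.feasible F b).Nonempty)
    (lp lm : ℝ → ℝ) (hloss : AbstainGame.IsPartialLosses lp lm)
    (hconv : ConvexOn ℝ Set.univ (AbstainGame.potential lp lm))
    (hdiff : Differentiable ℝ (AbstainGame.potential lp lm))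
    (c : ℝ) (hc : 0 ≤ c) :
    -- the inner maximum and the outer minimum of the game are attained
    (∀ s ∈ AbstainGame.strategies n,
      IsGreatest (AbstainGame.avgLoss lp lm c s.1 s.2 '' AbstainGame.feasible F b)
        (AbstainGame.worstLoss lp lm c F b s.1 s.2)) ∧
    IsLeast ((fun s => AbstainGame.worstLoss lp lm c F b s.1 s.2) '' AbstainGame.strategies n)
      (AbstainGame.gameValue lp lm c F b) ∧
    -- the minimum over the weight vectors is attained and gives the value of the game
    (∃ M : ℝ,
      IsLeast (AbstainGame.slack lp lm F b (2 * c) '' {σ : Fin d → ℝ | 0 ≤ σ}) M ∧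
      AbstainGame.gameValue lp lm c F b = 1 / 2 * M + c) ∧
    -- every minimizing weight vector yields a minimax optimal strategy
    (∀ σ : Fin d → ℝ, 0 ≤ σ →
      IsMinOn (AbstainGame.slack lp lm F b (2 * c)) {σ' : Fin d → ℝ | 0 ≤ σ'} σ →
      ∀ g q : Fin n → ℝ,
        (∀ j, q j = AbstainGame.optProb lp lm c (AbstainGame.exampleScore F σ j)) →
        (∀ j, g j = AbstainGame.optPred lp lm (q j) (AbstainGame.exampleScore F σ j)) →
        (g, q) ∈ AbstainGame.strategies n ∧
        AbstainGame.worstLoss lp lm c F b g q = AbstainGame.gameValue lp lm c F b) := by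
  have hleast := AbstainGame.isLeast_gameValue hloss c F b hfeas
  have hvalue_le : ∀ s ∈ AbstainGame.strategies n, AbstainGame.gameValue lp lm c F b ≤ AbstainGame.worstLoss lp lm c F b s.1 s.2 :=
    fun s hs => hleast.2 ⟨s, hs, rfl⟩
  have hopt : ∀ σ : Fin d → ℝ, 0 ≤ σ → ∀ g q : Fin n → ℝ,
      (∀ j, q j = AbstainGame.optProb lp lm c (AbstainGame.exampleScore F σ j)) →
      (∀ j, g j = AbstainGame.optPred lp lm (q j) (AbstainGame.exampleScore F σ j)) →
      2 * AbstainGame.worstLoss lp lm c F b g q ≤ AbstainGame.slack lp lm F b (2 * c) σ + 2 * c :=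
    fun σ hσ g q hq hg => by
      rw [← hloss.dualLoss_eq_slack hconv hdiff F b c σ hq hg]
      exact AbstainGame.two_mul_worstLoss_le hn F b hfeas c g q σ hσ
  have hlower : ∀ σ : Fin d → ℝ, 0 ≤ σ →
      2 * AbstainGame.gameValue lp lm c F b - 2 * c ≤ AbstainGame.slack lp lm F b (2 * c) σ := fun σ hσ => by
    have h₁ := hopt σ hσ _ _ (fun _ => rfl) (fun _ => rfl)
    have h₂ := hvalue_le _ (hloss.opt_mem_strategies F c σ (fun _ => rfl) (fun _ => rfl))
    simp only at h₂
    linarith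
  obtain ⟨⟨g₀, q₀⟩, hs₀, he₀⟩ := hleast.1
  -- The dual solution at an optimal strategy is the minimizing weight vector, so its existence
  -- needs no coercivity or continuity of `slack`.
  obtain ⟨σ₀, hσ₀, hle₀⟩ := AbstainGame.exists_dualLoss_le (lp := lp) (lm := lm) hn F b hfeas c g₀ q₀
  have hslack₀ := hloss.slack_le_dualLoss hconv hdiff F b (2 * c) hs₀ σ₀
  simp only at he₀
  refine ⟨fun s _ => AbstainGame.isGreatest_worstLoss lp lm c F b hfeas s.1 s.2, hleast,
    ⟨2 * AbstainGame.gameValue lp lm c F b - 2 * c, ⟨⟨σ₀, hσ₀, ?_⟩, ?_⟩, by ring⟩, ?_⟩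
  · exact le_antisymm (by linarith) (hlower σ₀ hσ₀)
  · rintro _ ⟨σ, hσ, rfl⟩
    exact hlower σ hσ
  · intro σ hσ hmin g q hq hg
    have hmem := hloss.opt_mem_strategies F c σ hq hg
    have h₁ := hopt σ hσ g q hq hg
    have h₂ : AbstainGame.slack lp lm F b (2 * c) σ ≤ AbstainGame.slack lp lm F b (2 * c) σ₀ := hmin hσ₀
    exact ⟨hmem, le_antisymm (by linarith) (hvalue_le _ hmem)⟩
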